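/- Let $k\ge 2$ be an integer, let $\sigma_k$ be the morphism on the finite words over $\{0,1,\dots,k-1\}$ given on letters by $\sigma_k(i)=i\,(i+1)\cdots(i+k-1)$ with every letter reduced modulo $k$, and let $\mathbf t^{(k)}=\sigma_k^\infty(0)$ be the infinite word that has every $\sigma_k^m(0)$, $m\ge 0$, as a prefix (the fixed point of $\sigma_k$ that begins with $0$). For an infinite word $\mathbf w=w_0w_1w_2\cdots$ over a finite alphabet, let the abelian complexity $\rho_n^{ab}(\mathbf w)$ be the number of distinct Parikh vectors of its factors $w_iw_{i+1}\cdots w_{i+n-1}$ $(i\ge 0)$ of length $n$, where the Parikh vector of a finite word lists the numbers of occurrences of each letter in it. Then for every integer $n\ge k$, with $r\in\{0,1,\dots,k-1\}$ such that $n\equiv r \pmod k$, \[ \rho_n^{ab}(\mathbf t^{(k)})= \begin{cases} \frac14 k(k^2-1)+1 & \text{if $k$ is odd and $r=0$},\\ \frac14 k(k-1)^2+k & \text{if $k$ is odd and $r\ne 0$},\\ \frac14 k^3+1 & \text{if $k$ is even and $r=0$},\\ \frac14 k(k-1)^2+\frac54 k & \text{if $k$ is even and $r\neq 0$ is even},\\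 \frac14 k^2(k-2)+k & \text{if $k$ is even and $r$ is odd}. \end{cases} \] -/

import Mathlib

/-- The image of a finite word under the morphism of free monoids that extends `σ` from letters. -/
def applyMorphism {α : Type*} (σ : α → List α) (w : List α) : List α :=
  w.flatMap σ

/-- The morphism `σ_k` on letters: `i ↦ i (i+1) ⋯ (i+k-1)`, each letter reduced modulo `k`. -/
def sigma (k : ℕ) (i : Fin k) : List (Fin k) :=
  List.ofFn fun j : Fin k => ⟨(i.val + j.val) % k, Nat.mod_lt _ i.pos⟩

/-- The finite word `σ_k^m(0)`. -/
def sigmaIter (k : ℕ) (hk : 2 ≤ k) (m : ℕ) : List (Fin k) :=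
  (applyMorphism (sigma k))^[m] [⟨0, by omega⟩]

theorem length_sigmaIter (k : ℕ) (hk : 2 ≤ k) (m : ℕ) :
    (sigmaIter k hk m).length = k ^ m := by
  induction m with
  | zero => simp [sigmaIter]
  | succ m ih =>
    have h : sigmaIter k hk (m + 1) = applyMorphism (sigma k) (sigmaIter k hk m) :=
      Function.iterate_succ_apply' _ _ _
    rw [h, applyMorphism, List.length_flatMap]
    simp [sigma, ih, pow_succ]

/-- The generalized Thue-Morse word `t^(k) = σ_k^∞(0)`, the limit of the words `σ_k^m(0)`: its
letter at position `n` is the one of `σ_k^n(0)`, whose length is `k ^ n > n`. That every `σ_k^m(0)`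
is a prefix of it is `ofFn_genThueMorse`. -/
def genThueMorse (k : ℕ) (hk : 2 ≤ k) (n : ℕ) : Fin k :=
  (sigmaIter k hk n)[n]'(by rw [length_sigmaIter]; exact Nat.lt_pow_self (by omega))

theorem sigmaIter_prefix_succ (k : ℕ) (hk : 2 ≤ k) (m : ℕ) :
    sigmaIter k hk m <+: sigmaIter k hk (m + 1) := by
  induction m with
  | zero =>
    obtain ⟨l, rfl⟩ : ∃ l, k = l + 1 := ⟨k - 1, by omega⟩
    simp [sigmaIter, applyMorphism, sigma, List.ofFn_succ]
  | succ m ih =>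
    have h : ∀ j, sigmaIter k hk (j + 1) = applyMorphism (sigma k) (sigmaIter k hk j) :=
      fun j => Function.iterate_succ_apply' _ _ _
    rw [h (m + 1)]
    nth_rewrite 1 [h m]
    obtain ⟨s, hs⟩ := ih
    rw [← hs]
    simp [applyMorphism]

theorem sigmaIter_prefix (k : ℕ) (hk : 2 ≤ k) {m n : ℕ} (h : m ≤ n) :
    sigmaIter k hk m <+: sigmaIter k hk n := by
  induction n, h using Nat.le_induction with
  | base => exact List.prefix_refl _
  | succ n _ ih => exact ih.trans (sigmaIter_prefix_succ k hk n)

/-- Every `σ_k^m(0)` is a prefix of `t^(k)`. -/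
theorem ofFn_genThueMorse (k : ℕ) (hk : 2 ≤ k) (m : ℕ) :
    List.ofFn (fun i : Fin (k ^ m) => genThueMorse k hk i) = sigmaIter k hk m := by
  apply List.ext_getElem
  · simp [length_sigmaIter]
  · intro i h₁ h₂
    simp only [List.getElem_ofFn, genThueMorse]
    rcases le_total m i with h | h
    · exact ((sigmaIter_prefix k hk h).getElem h₂).symm
    · exact (sigmaIter_prefix k hk h).getElem _

/-- The set of the factors of length `n` of the infinite word `w`. -/
def factors {α : Type*} (w : ℕ → α) (n : ℕ) : Set (List α) :=
  {u | ∃ i : ℕ, u = List.ofFn fun j : Fin n => w (i + j)}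

/-- The Parikh vector of a finite word: the number of occurrences of each letter. -/
def parikh {α : Type*} [DecidableEq α] (u : List α) : α → ℕ :=
  fun a => u.count a

/-- The set of the Parikh vectors of the factors of length `n` of `w`. -/
def parikhSet {α : Type*} [DecidableEq α] (w : ℕ → α) (n : ℕ) : Set (α → ℕ) :=
  parikh '' factors w n

/-- Over a finite alphabet the set counted by `abelianComplexity` is finite. -/
theorem finite_parikhSet {α : Type*} [DecidableEq α] [Finite α] (w : ℕ → α) (n : ℕ) :
    (parikhSet w n).Finite := by
  refine Set.Finite.image _ ((List.finite_length_eq α n).subset ?_)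
  rintro u ⟨i, rfl⟩
  simp

/-- The abelian complexity of the infinite word `w` over a finite alphabet: the number of the
Parikh vectors of its factors of length `n`. -/
noncomputable def abelianComplexity {α : Type*} [DecidableEq α] [Finite α]
    (w : ℕ → α) (n : ℕ) : ℕ :=
  (parikhSet w n).ncard

/-! Write t for the word and e_c for the indicator of a letter c. Among vectors of fixed total, a
Parikh vector v is determined by its cyclic derivative v(j) - v(j-1). A letter c contributes e_c -
e_{c+1}, so complete blocks σ_k(c) telescope to zero and only the two cut blocks at the ends of a
factor count. The derivative is e_x + e_y - e_z - e_w with z + w = x + y + n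
(`discreteDeriv_parikh_factor`). For n ≥ k every such quadruple arises, because any two letters
occur at any positive distance (`exists_genThueMorse_pair`).

It remains to count these differences over pairs (A, B) of unordered pairs with sum B = sum A + r.
Disjoint A and B can be read off from the difference; meeting ones collapse to e_z - e_{z+r}
(`card_image_shiftedPairs`). The number of all (A, B) depends on the number of solutions of u + u =
r, whence the parity cases. -/

/-! ### Block structure and pairs of letters at a given distance -/

open scoped Fin.CommRing in
theorem sigma_getElem (k : ℕ) [NeZero k] (c : Fin k) (s : ℕ) (hs : s < k) :
    (sigma k c)[s]? = some (c + (s : Fin k)) := by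
  simp [sigma, hs, Fin.ext_iff, Fin.val_add, Nat.mod_eq_of_lt hs]

open scoped Fin.CommRing in
theorem applyMorphism_sigma_getElem (k : ℕ) [NeZero k] (w : List (Fin k)) (a s : ℕ)
    (hs : s < k) :
    (applyMorphism (sigma k) w)[k * a + s]? = w[a]?.map (· + (s : Fin k)) := by
  induction w generalizing a with
  | nil => simp [applyMorphism]
  | cons c w ih =>
    have hl : (sigma k c).length = k := by simp [sigma]
    have hc : applyMorphism (sigma k) (c :: w) = sigma k c ++ applyMorphism (sigma k) w := by
      simp [applyMorphism]
    rw [hc]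
    cases a with
    | zero => rw [List.getElem?_append_left (by omega)]; simp [sigma_getElem, hs]
    | succ a =>
      rw [List.getElem?_append_right (by rw [hl, mul_add]; omega), hl, List.getElem?_cons_succ,
        ← ih a]
      congr 1
      rw [mul_add]; omega

theorem sigmaIter_getElem (k : ℕ) (hk : 2 ≤ k) (m n : ℕ) (h : n < k ^ m) :
    (sigmaIter k hk m)[n]? = some (genThueMorse k hk n) := by
  simp [← ofFn_genThueMorse, h]

open scoped Fin.CommRing in
theorem genThueMorse_mul_add (k : ℕ) [NeZero k] (hk : 2 ≤ k) (a s : ℕ) (hs : s < k) :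
    genThueMorse k hk (k * a + s) = genThueMorse k hk a + (s : Fin k) := by
  have ha : a < k ^ a := Nat.lt_pow_self (by omega)
  have h1 := sigmaIter_getElem k hk (a + 1) (k * a + s) (by
    rw [pow_succ']
    calc k * a + s < k * (a + 1) := by rw [mul_add]; omega
      _ ≤ _ := Nat.mul_le_mul_left _ ha)
  have h2 : sigmaIter k hk (a + 1) = applyMorphism (sigma k) (sigmaIter k hk a) :=
    Function.iterate_succ_apply' _ _ _
  rw [h2, applyMorphism_sigma_getElem k _ _ _ hs, sigmaIter_getElem k hk a a ha] at h1
  simpa using h1.symm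

theorem genThueMorse_zero (k : ℕ) [NeZero k] (hk : 2 ≤ k) : genThueMorse k hk 0 = 0 := by
  simp [genThueMorse, sigmaIter]

theorem genThueMorse_mul (k : ℕ) (hk : 2 ≤ k) (a : ℕ) :
    genThueMorse k hk (k * a) = genThueMorse k hk a := by
  have : NeZero k := ⟨by omega⟩
  simpa using genThueMorse_mul_add k hk a 0 (by omega)

theorem genThueMorse_surjective (k : ℕ) [NeZero k] (hk : 2 ≤ k) (x : Fin k) :
    ∃ a, genThueMorse k hk a = x := by
  refine ⟨x, ?_⟩
  have := genThueMorse_mul_add k hk 0 x x.2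
  rw [genThueMorse_zero] at this
  simpa using this

-- Inside a block the step is 1. From the last letter of a block to the first of the next, letters x
-- + 1, x + 2 + j at u, u + 1 yield x, x + 2 + j, so each passage to block boundaries raises the
-- jump by one.
open scoped Fin.CommRing in
theorem exists_genThueMorse_succ (k : ℕ) [NeZero k] (hk : 2 ≤ k) (j : ℕ) (x : Fin k) :
    ∃ u, genThueMorse k hk u = x ∧ genThueMorse k hk (u + 1) = x + 1 + (j : Fin k) := by
  induction j generalizing x with
  | zero =>
    obtain ⟨v, rfl⟩ := genThueMorse_surjective k hk x
    refine ⟨k * v, genThueMorse_mul k hk v, ?_⟩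
    simpa using genThueMorse_mul_add k hk v 1 (by omega)
  | succ j ih =>
    obtain ⟨u, h1, h2⟩ := ih (x + 1)
    refine ⟨k * u + (k - 1), ?_, ?_⟩
    · rw [genThueMorse_mul_add k hk u (k - 1) (by omega), h1, Nat.cast_sub (by omega)]
      simp
    · rw [show k * u + (k - 1) + 1 = k * (u + 1) by rw [mul_add]; omega, genThueMorse_mul, h2]
      push_cast
      ring

open scoped Fin.CommRing in
/-- Every pair of letters occurs in the word at every positive distance `d`. -/
theorem exists_genThueMorse_pair (k : ℕ) [NeZero k] (hk : 2 ≤ k) (d : ℕ) (hd : 0 < d)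
    (x y : Fin k) :
    ∃ a, genThueMorse k hk a = x ∧ genThueMorse k hk (a + d) = y := by
  induction d using Nat.strong_induction_on generalizing x y with
  | _ d ih =>
    have hdk := Nat.div_add_mod d k
    have he : d % k < k := Nat.mod_lt _ (by omega)
    rcases Nat.eq_zero_or_pos (d / k) with h0 | h0
    -- Start at the last letter of block u: distance d then ends at offset d - 1 of block u + 1, so
    -- t(u) = x + 1 and t(u + 1) = y - (d - 1) are needed.
    · obtain ⟨u, h1, h2⟩ := exists_genThueMorse_succ k hk
        (y - ((d - 1 : ℕ) : Fin k) - (x + 1) - 1).val (x + 1)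
      have hlt : d < k := by rw [h0] at hdk; omega
      refine ⟨k * u + (k - 1), ?_, ?_⟩
      · rw [genThueMorse_mul_add k hk u (k - 1) (by omega), h1, Nat.cast_sub (by omega)]
        simp
      · rw [show k * u + (k - 1) + d = k * (u + 1) + (d - 1) by rw [mul_add]; omega,
          genThueMorse_mul_add k hk _ _ (by omega), h2, Fin.cast_val_eq_self]
        ring
    · obtain ⟨a, h1, h2⟩ := ih (d / k) (Nat.div_lt_self hd hk) h0 x (y - ((d % k : ℕ) : Fin k))
      refine ⟨k * a, by rw [genThueMorse_mul, h1], ?_⟩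
      rw [show k * a + d = k * (a + d / k) + d % k by rw [mul_add]; omega,
        genThueMorse_mul_add k hk _ _ he, h2]
      ring

/-! ### Derivatives of Parikh vectors -/

/-- The discrete derivative of a function on a group with a distinguished step `1`. -/
def discreteDeriv {G : Type*} [Sub G] [One G] (v : G → ℕ) (j : G) : ℤ :=
  (v j : ℤ) - v (j - 1)

-- Equal derivatives make v - w constant around the cycle, and equal sums make that constant zero.
open scoped Fin.CommRing in
theorem eq_of_discreteDeriv_eq (k : ℕ) [NeZero k] (v w : Fin k → ℕ)
    (h : discreteDeriv v = discreteDeriv w) (hs : ∑ j, v j = ∑ j, w j) : v = w := by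
  have hconst : ∀ m : ℕ, (v (m : Fin k) : ℤ) - w (m : Fin k) = v 0 - w 0 := by
    intro m
    induction m with
    | zero => simp
    | succ m ih =>
      have := congrFun h ((m + 1 : ℕ) : Fin k)
      simp only [discreteDeriv, Nat.cast_add, Nat.cast_one, add_sub_cancel_right] at this ⊢
      linarith
  have hc : ∀ j : Fin k, (v j : ℤ) - w j = v 0 - w 0 := fun j => by
    simpa using hconst j.val
  have hsum : ∑ j : Fin k, ((v j : ℤ) - w j) = 0 := by
    rw [Finset.sum_sub_distrib, sub_eq_zero]
    exact_mod_cast hs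
  simp only [hc, Finset.sum_const, Finset.card_univ, Fintype.card_fin, smul_eq_zero] at hsum
  have h0 := hsum.resolve_left (NeZero.ne k)
  funext j
  have := hc j
  omega

theorem count_ofFn {α : Type*} [DecidableEq α] (n : ℕ) (f : ℕ → α) (c : α) :
    (List.ofFn fun j : Fin n => f j).count c = ∑ j ∈ Finset.range n, if f j = c then 1 else 0 := by
  induction n with
  | zero => simp
  | succ n ih =>
    rw [List.ofFn_succ', List.concat_eq_append, List.count_append, Finset.sum_range_succ]
    simp only [Fin.val_castSucc, ih, Fin.val_last]
    simp [List.count_singleton]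

open scoped Fin.CommRing in
/-- The letters up to position `n` contribute to the derivative of the Parikh vector only through
the last, incomplete block. -/
theorem sum_range_single_genThueMorse (k : ℕ) [NeZero k] (hk : 2 ≤ k) (n : ℕ) :
    ∑ j ∈ Finset.range n, (Pi.single (genThueMorse k hk j) 1 -
      Pi.single (genThueMorse k hk j + 1) 1 : Fin k → ℤ) =
    Pi.single (genThueMorse k hk (n / k)) 1 -
      Pi.single (genThueMorse k hk (n / k) + (n : Fin k)) 1 := by
  have ht : ∀ m, genThueMorse k hk m = genThueMorse k hk (m / k) + (m : Fin k) := by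
    intro m
    have h := genThueMorse_mul_add k hk (m / k) (m % k) (Nat.mod_lt _ (by omega))
    rw [Nat.div_add_mod] at h
    rw [h]
    congr 1
    ext
    simp
  induction n with
  | zero => simp
  | succ n ih =>
    rw [Finset.sum_range_succ, ih, ht n]
    -- The new term telescopes with the old one; when it completes a block, the two remaining
    -- indicators cancel.
    by_cases hd : k ∣ n + 1
    · obtain ⟨q, hq⟩ := hd
      have hz : ((n + 1 : ℕ) : Fin k) = 0 := by rw [hq]; simp
      rw [hz, add_assoc, show (n : Fin k) + 1 = 0 by rw [← hz]; push_cast; rfl]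
      simp
    · rw [Nat.succ_div_of_not_dvd hd]
      push_cast
      rw [add_assoc]
      abel

open scoped Fin.CommRing in
theorem discreteDeriv_parikh_factor (k : ℕ) [NeZero k] (hk : 2 ≤ k) (n i : ℕ) :
    discreteDeriv (parikh (List.ofFn fun j : Fin n => genThueMorse k hk (i + j))) =
      (Pi.single (genThueMorse k hk ((i + n) / k)) 1 +
        Pi.single (genThueMorse k hk (i / k) + (i : Fin k)) 1) -
      (Pi.single (genThueMorse k hk ((i + n) / k) + ((i + n : ℕ) : Fin k)) 1 +
        Pi.single (genThueMorse k hk (i / k)) 1) := by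
  have h1 := sum_range_single_genThueMorse k hk (i + n)
  rw [Finset.sum_range_add, sum_range_single_genThueMorse k hk i] at h1
  have h2 : discreteDeriv (parikh (List.ofFn fun j : Fin n => genThueMorse k hk (i + j))) =
      ∑ j ∈ Finset.range n, (Pi.single (genThueMorse k hk (i + j)) 1 -
        Pi.single (genThueMorse k hk (i + j) + 1) 1 : Fin k → ℤ) := by
    funext c
    simp only [discreteDeriv, parikh, count_ofFn n (fun j => genThueMorse k hk (i + j)),
      Finset.sum_apply, Pi.sub_apply, Finset.sum_sub_distrib]
    push_cast
    congr 1 <;> refine Finset.sum_congr rfl fun j _ => ?_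
    · simp [Pi.single_apply, eq_comm]
    · simp [Pi.single_apply, eq_comm, eq_sub_iff_add_eq]
  rw [h2, eq_sub_of_add_eq' h1]
  abel

theorem sum_parikh {α : Type*} [DecidableEq α] [Fintype α] (u : List α) :
    ∑ a, parikh u a = u.length := by
  simpa [parikh] using Multiset.sum_count_eq_card (s := Finset.univ) (m := (u : Multiset α))
    (by simp)

theorem injOn_discreteDeriv_parikhSet (k : ℕ) [NeZero k] (w : ℕ → Fin k) (n : ℕ) :
    Set.InjOn discreteDeriv (parikhSet w n) := by
  rintro _ ⟨_, ⟨i, rfl⟩, rfl⟩ _ ⟨_, ⟨j, rfl⟩, rfl⟩ h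
  refine eq_of_discreteDeriv_eq k _ _ h ?_
  simp [sum_parikh]

open scoped Fin.CommRing in
theorem discreteDeriv_image_parikhSet (k n : ℕ) [NeZero k] (hk : 2 ≤ k) (hn : k ≤ n) :
    discreteDeriv '' parikhSet (genThueMorse k hk) n =
      {D | ∃ x y z w : Fin k, z + w = x + y + (n : Fin k) ∧
        D = (Pi.single x 1 + Pi.single y 1) - (Pi.single z 1 + Pi.single w 1 : Fin k → ℤ)} := by
  ext D
  constructor
  · rintro ⟨_, ⟨_, ⟨i, rfl⟩, rfl⟩, rfl⟩
    refine ⟨_, _, _, _, ?_, discreteDeriv_parikh_factor k hk n i⟩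
    push_cast
    ring
  · rintro ⟨x, y, z, w, h, rfl⟩
    have hlt : (y - w).val < k := (y - w).2
    -- The factor starts at offset y - w of a block with first letter w, hence at the letter y; its
    -- end falls in a block with first letter x. The hypothesis k ≤ n makes the block distance
    -- positive.
    obtain ⟨a, h1, h2⟩ := exists_genThueMorse_pair k hk (((y - w).val + n) / k)
      (Nat.div_pos (by omega) (by omega)) w x
    refine ⟨_, ⟨_, ⟨k * a + (y - w).val, rfl⟩, rfl⟩, ?_⟩
    have hz : z = x + (y - w) + (n : Fin k) := by
      rw [eq_sub_of_add_eq h]; ring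
    rw [discreteDeriv_parikh_factor, add_assoc, Nat.mul_add_div (by omega), h2,
      Nat.mul_add_div (by omega), Nat.div_eq_of_lt hlt, add_zero, h1]
    simp [hz, add_assoc]

/-! ### Counting differences of unordered pairs in a finite abelian group -/

/-- The sum of the two elements of an unordered pair. -/
def pairSum {G : Type*} [AddCommGroup G] (A : Sym2 G) : G :=
  Sym2.lift ⟨fun a b => a + b, add_comm⟩ A

/-- The multiplicity function of an unordered pair. -/
def pairInd {G : Type*} [DecidableEq G] (A : Sym2 G) : G → ℤ :=
  Sym2.lift ⟨fun a b => Pi.single a 1 + Pi.single b 1, fun _ _ => add_comm _ _⟩ A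

/-- The number of the solutions of `u + u = c`. -/
def halfCard {G : Type*} [AddCommGroup G] [Fintype G] [DecidableEq G] (c : G) : ℕ :=
  (Finset.univ.filter fun u : G => u + u = c).card

/-- The pairs of unordered pairs whose sums differ by `r`. -/
def shiftedPairs {G : Type*} [AddCommGroup G] [Fintype G] [DecidableEq G] (r : G) :
    Finset (Sym2 G × Sym2 G) :=
  Finset.univ.filter fun p => pairSum p.2 = pairSum p.1 + r

@[simp]
theorem pairSum_mk {G : Type*} [AddCommGroup G] (a b : G) : pairSum s(a, b) = a + b := rfl

@[simp]
theorem pairInd_mk {G : Type*} [DecidableEq G] (a b : G) :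
    pairInd s(a, b) = Pi.single a 1 + Pi.single b 1 := rfl

theorem pairInd_nonneg {G : Type*} [DecidableEq G] (A : Sym2 G) (j : G) : 0 ≤ pairInd A j := by
  induction A with
  | _ a b =>
    simp only [pairInd_mk, Pi.add_apply, Pi.single_apply]
    split_ifs <;> simp

theorem pairInd_eq_zero_iff {G : Type*} [DecidableEq G] (A : Sym2 G) (j : G) :
    pairInd A j = 0 ↔ j ∉ A := by
  induction A with
  | _ a b =>
    simp only [pairInd_mk, Pi.add_apply, Pi.single_apply, Sym2.mem_iff]
    split_ifs <;> simp_all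

theorem sum_pairInd {G : Type*} [DecidableEq G] [Fintype G] (A : Sym2 G) :
    ∑ j, pairInd A j = 2 := by
  induction A with
  | _ a b => simp [Finset.sum_add_distrib]

theorem pairInd_injective {G : Type*} [DecidableEq G] :
    Function.Injective (pairInd : Sym2 G → G → ℤ) := by
  intro A B h
  induction A with
  | _ a b =>
  induction B with
  | _ c d =>
    have ha := congrFun h a
    have hb := congrFun h b
    have hc := congrFun h c
    have hd := congrFun h d
    simp only [pairInd_mk, Pi.add_apply, Pi.single_apply] at ha hb hc hd
    rw [Sym2.eq_iff]
    grind

theorem max_pairInd_sub_eq {G : Type*} [DecidableEq G] {A B : Sym2 G}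
    (h : ∀ j, ¬(j ∈ A ∧ j ∈ B)) (j : G) : max (pairInd A j - pairInd B j) 0 = pairInd A j := by
  have hA := pairInd_nonneg A j
  have hB := pairInd_nonneg B j
  by_cases hj : j ∈ A
  · have h0 := (pairInd_eq_zero_iff B j).2 fun hb => h j ⟨hj, hb⟩
    rw [h0, sub_zero, max_eq_left hA]
  · rw [(pairInd_eq_zero_iff A j).2 hj, max_eq_right (by linarith)]

/-- An unordered pair has two orderings, except that a diagonal one has a single ordering; the
second term makes up the defect. -/
theorem card_mk_fiber_add {G : Type*} [DecidableEq G] [Fintype G] (A : Sym2 G) :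
    (Finset.univ.filter fun p : G × G => s(p.1, p.2) = A).card +
      (Finset.univ.filter fun u : G => s(u, u) = A).card = 2 := by
  induction A with
  | _ a b =>
    have h1 : (Finset.univ.filter fun p : G × G => s(p.1, p.2) = s(a, b)) = {(a, b), (b, a)} := by
      ext ⟨x, y⟩; simp
    rw [h1]
    by_cases hab : a = b
    · subst hab
      have h2 : (Finset.univ.filter fun u : G => s(u, u) = s(a, a)) = {a} := by ext; simp
      rw [h2]
      simp
    · have h2 : (Finset.univ.filter fun u : G => s(u, u) = s(a, b)) = ∅ := by
        ext u; simp only [Sym2.eq_iff, Finset.mem_filter]; grind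
      rw [h2, Finset.card_pair (by simp [hab])]
      simp

section PairCount

variable {G : Type*} [AddCommGroup G] [Fintype G] [DecidableEq G]

theorem two_mul_card_pairSum_eq (c : G) :
    2 * (Finset.univ.filter fun A : Sym2 G => pairSum A = c).card =
      Fintype.card G + halfCard c := by
  have h1 : (Finset.univ.filter fun p : G × G => p.1 + p.2 = c).card = Fintype.card G := by
    rw [← Finset.card_univ]
    refine Finset.card_bij' (fun p _ => p.1) (fun a _ => (a, c - a)) ?_ ?_ ?_ ?_ <;> simp
    rintro a b rfl
    simp
  have h2 := Finset.card_eq_sum_card_fiberwise (f := fun p : G × G => s(p.1, p.2))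
    (s := Finset.univ.filter fun p : G × G => p.1 + p.2 = c)
    (t := Finset.univ.filter fun A : Sym2 G => pairSum A = c) (by intro p; simp)
  have h3 := Finset.card_eq_sum_card_fiberwise (f := fun u : G => s(u, u))
    (s := Finset.univ.filter fun u : G => u + u = c)
    (t := Finset.univ.filter fun A : Sym2 G => pairSum A = c) (by intro p; simp)
  rw [halfCard, h3, ← h1, h2, ← Finset.sum_add_distrib, mul_comm, ← smul_eq_mul,
    ← Finset.sum_const]
  refine Finset.sum_congr rfl fun A hA => ?_
  rw [← card_mk_fiber_add A, Finset.filter_filter, Finset.filter_filter]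
  simp only [Finset.mem_filter, Finset.mem_univ, true_and] at hA
  congr 2
  · ext p; simp only [Finset.mem_filter, Finset.mem_univ, true_and]
    constructor
    · rintro rfl; exact ⟨hA, rfl⟩
    · exact And.right
  · ext p; simp only [Finset.mem_filter, Finset.mem_univ, true_and]
    constructor
    · rintro rfl; exact ⟨hA, rfl⟩
    · exact And.right

theorem sum_halfCard_mul (g : G → ℕ) : ∑ c, halfCard c * g c = ∑ u : G, g (u + u) := by
  simp only [halfCard, Finset.card_filter, Finset.sum_mul]
  rw [Finset.sum_comm]
  simp

/-- Translation by u matches the two solution sets. -/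
theorem halfCard_add_self_add (u r : G) : halfCard (u + u + r) = halfCard r := by
  refine Finset.card_bij' (fun v _ => v - u) (fun v _ => v + u) ?_ ?_ ?_ ?_ <;>
    simp only [Finset.mem_filter, Finset.mem_univ, true_and, sub_add_cancel, add_sub_cancel_right,
      implies_true]
  · intro v hv
    rw [sub_add_sub_comm, hv, add_sub_cancel_left]
  · rintro v rfl
    abel

theorem four_mul_card_shiftedPairs (r : G) :
    4 * (shiftedPairs r).card =
      Fintype.card G ^ 3 + 2 * Fintype.card G ^ 2 + Fintype.card G * halfCard r := by
  -- Sort by c, the sum of the first pair.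
  have h1 : (shiftedPairs r).card = ∑ c : G,
      (Finset.univ.filter fun A : Sym2 G => pairSum A = c).card *
      (Finset.univ.filter fun A : Sym2 G => pairSum A = c + r).card := by
    rw [Finset.card_eq_sum_card_fiberwise (f := fun p => pairSum p.1) (t := Finset.univ)
      (by intro; simp)]
    refine Finset.sum_congr rfl fun c _ => ?_
    rw [← Finset.card_product]
    congr 1
    ext ⟨A, B⟩
    simp only [shiftedPairs, Finset.mem_filter, Finset.mem_univ, true_and, Finset.mem_product]
    constructor
    · rintro ⟨h, rfl⟩; exact ⟨rfl, h⟩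
    · rintro ⟨rfl, h⟩; exact ⟨h, rfl⟩
  have h2 : ∑ c : G, halfCard c = Fintype.card G := by
    simpa using sum_halfCard_mul (G := G) fun _ => 1
  have h3 : ∑ c : G, halfCard (c + r) = Fintype.card G := by
    rw [← h2]; exact Equiv.sum_comp (Equiv.addRight r) halfCard
  have h4 : ∑ c : G, halfCard c * halfCard (c + r) = Fintype.card G * halfCard r := by
    rw [sum_halfCard_mul fun c => halfCard (c + r)]
    simp [halfCard_add_self_add]
  calc 4 * (shiftedPairs r).card
      = ∑ c : G, (Fintype.card G + halfCard c) * (Fintype.card G + halfCard (c + r)) := by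
        rw [h1, Finset.mul_sum]
        refine Finset.sum_congr rfl fun c _ => ?_
        rw [← two_mul_card_pairSum_eq, ← two_mul_card_pairSum_eq]
        ring
    _ = _ := by
        simp only [add_mul, mul_add, Finset.sum_add_distrib, h4, ← Finset.mul_sum,
          ← Finset.sum_mul, h2, h3]
        simp
        ring

/-- The members of `shiftedPairs r` whose two unordered pairs have an element in common. -/
def meetingPairs (r : G) : Finset (Sym2 G × Sym2 G) :=
  (shiftedPairs r).filter fun p => ∃ j, j ∈ p.1 ∧ j ∈ p.2

theorem mem_meetingPairs (r : G) (p : Sym2 G × Sym2 G) :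
    p ∈ meetingPairs r ↔ ∃ y z, (s(y, z), s(y, z + r)) = p := by
  constructor
  · rcases p with ⟨A, B⟩
    simp only [meetingPairs, shiftedPairs, Finset.mem_filter, Finset.mem_univ, true_and]
    rintro ⟨h, j, ⟨z, rfl⟩, ⟨w, rfl⟩⟩
    refine ⟨j, z, ?_⟩
    simp only [pairSum_mk, add_assoc, add_right_inj] at h
    rw [h]
  · rintro ⟨y, z, rfl⟩
    simp only [meetingPairs, shiftedPairs, Finset.mem_filter, Finset.mem_univ, true_and]
    exact ⟨by simp [add_assoc], y, by simp, by simp⟩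

/-- Two pairs with equal sums and a common element coincide, so this counts the diagonal of `Sym2 G
× Sym2 G`. -/
theorem two_mul_card_meetingPairs_zero :
    2 * (meetingPairs (0 : G)).card = Fintype.card G ^ 2 + Fintype.card G := by
  have h : (meetingPairs (0 : G)).card = Fintype.card (Sym2 G) := by
    rw [← Finset.card_univ]
    refine Finset.card_bij' (fun p _ => p.1) (fun A _ => (A, A)) ?_ ?_ ?_ ?_
    · simp
    · intro A _
      induction A with
      | _ a b => rw [mem_meetingPairs]; exact ⟨a, b, by simp⟩
    · intro p hp
      obtain ⟨y, z, rfl⟩ := (mem_meetingPairs _ _).1 hp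
      simp
    · simp
  rw [h, Sym2.card, Nat.choose_two_right, Nat.mul_div_cancel' (Nat.even_mul_pred_self _).two_dvd]
  simp
  ring

theorem card_meetingPairs (r : G) (hr : r ≠ 0) :
    (meetingPairs r).card = Fintype.card G ^ 2 := by
  have h : meetingPairs r =
      Finset.univ.image fun p : G × G => (s(p.1, p.2), s(p.1, p.2 + r)) := by
    ext p
    simp [mem_meetingPairs]
  rw [h, Finset.card_image_of_injective]
  · simp [sq]
  · rintro ⟨a, b⟩ ⟨c, d⟩ h
    simp only [Prod.mk.injEq, Sym2.eq_iff] at h ⊢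
    rcases h with ⟨h1 | ⟨h1, h2⟩, h3 | ⟨h3, h4⟩⟩
    · exact h1
    · exact h1
    · exact ⟨h3.1, h2.trans (h3.1.symm.trans h1)⟩
    · exact absurd (by rw [h1] at h3; exact left_eq_add.1 h3) hr

theorem card_image_shiftedPairs (r : G) :
    ((shiftedPairs r).image fun p => pairInd p.1 - pairInd p.2).card + (meetingPairs r).card =
      (shiftedPairs r).card + if r = 0 then 1 else Fintype.card G := by
  set F : Sym2 G × Sym2 G → G → ℤ := fun p => pairInd p.1 - pairInd p.2
  set N := (shiftedPairs r).filter fun p => ¬ ∃ j, j ∈ p.1 ∧ j ∈ p.2 with hN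
  have hpos : ∀ p ∈ N, ∀ j, max (F p j) 0 = pairInd p.1 j := by
    intro p hp j
    exact max_pairInd_sub_eq (not_exists.1 (Finset.mem_filter.1 hp).2) j
  have hinj : Set.InjOn F N := by
    intro p hp q hq h
    have h1 : pairInd p.1 = pairInd q.1 := by
      funext j
      rw [← hpos p hp j, ← hpos q hq j, h]
    have h2 : pairInd p.2 = pairInd q.2 := by
      have : pairInd p.1 - pairInd p.2 = pairInd q.1 - pairInd q.2 := h
      rwa [h1, sub_right_inj] at this
    exact Prod.ext (pairInd_injective h1) (pairInd_injective h2)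
  have hM : (meetingPairs r).image F =
      Finset.univ.image fun z : G => (Pi.single z 1 - Pi.single (z + r) 1 : G → ℤ) := by
    ext D
    simp only [Finset.mem_image, mem_meetingPairs, Finset.mem_univ, true_and]
    constructor
    · rintro ⟨_, ⟨y, z, rfl⟩, rfl⟩
      exact ⟨z, by simp [F]⟩
    · rintro ⟨z, rfl⟩
      exact ⟨_, ⟨0, z, rfl⟩, by simp [F]⟩
  have hMcard : ((meetingPairs r).image F).card = if r = 0 then 1 else Fintype.card G := by
    rw [hM]
    split_ifs with h0
    · subst h0
      simp [Finset.image_const Finset.univ_nonempty]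
    · rw [Finset.card_image_of_injective, Finset.card_univ]
      intro a b hab
      have := congrFun hab a
      simp only [Pi.sub_apply, Pi.single_apply, if_true, left_eq_add, h0, if_false] at this
      by_contra hne
      simp only [hne, if_false] at this
      split_ifs at this <;> omega
  -- The positive part has total mass 2 for disjoint pairs, but at most 1 for meeting ones.
  have hdisj : Disjoint (N.image F) ((meetingPairs r).image F) := by
    rw [hM, Finset.disjoint_left]
    intro D hD hD'
    obtain ⟨p, hp, rfl⟩ := Finset.mem_image.1 hD
    obtain ⟨z, -, hz⟩ := Finset.mem_image.1 hD'
    have h2 : ∑ j, max (F p j) 0 = 2 := by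
      rw [← sum_pairInd p.1]
      exact Finset.sum_congr rfl fun j _ => hpos p hp j
    have h1 : ∑ j, max (F p j) 0 ≤ ∑ j, (Pi.single z 1 : G → ℤ) j := by
      refine Finset.sum_le_sum fun j _ => ?_
      rw [← hz]
      simp only [Pi.sub_apply, Pi.single_apply]
      split_ifs <;> simp
    rw [h2] at h1
    simp at h1
  have hsplit : (shiftedPairs r).image F = N.image F ∪ (meetingPairs r).image F := by
    rw [← Finset.image_union, Finset.union_comm, meetingPairs, hN, Finset.filter_union_filter_not_eq]
  have hcard : (meetingPairs r).card + N.card = (shiftedPairs r).card :=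
    Finset.card_filter_add_card_filter_not _
  rw [hsplit, Finset.card_union_of_disjoint hdisj, Finset.card_image_of_injOn hinj, hMcard]
  omega

end PairCount

/-! ### Abelian complexity and halving modulo k -/

open scoped Fin.CommRing in
theorem abelianComplexity_genThueMorse (k n : ℕ) [NeZero k] (hk : 2 ≤ k) (hn : k ≤ n) :
    abelianComplexity (genThueMorse k hk) n =
      ((shiftedPairs (n : Fin k)).image fun p => pairInd p.1 - pairInd p.2).card := by
  rw [abelianComplexity, ← (injOn_discreteDeriv_parikhSet k _ n).ncard_image,
    discreteDeriv_image_parikhSet k n hk hn, ← Set.ncard_coe_finset]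
  congr 1
  ext D
  simp only [Set.mem_ofPred_eq, Finset.coe_image, Set.mem_image, Finset.mem_coe, shiftedPairs,
    Finset.mem_filter, Finset.mem_univ, true_and, Prod.exists]
  constructor
  · rintro ⟨x, y, z, w, h, rfl⟩
    exact ⟨s(x, y), s(z, w), h, rfl⟩
  · rintro ⟨A, B, h, rfl⟩
    induction A with
    | _ x y =>
    induction B with
    | _ z w => exact ⟨x, y, z, w, h, rfl⟩

theorem add_self_eq_iff (k : ℕ) [NeZero k] (u c : Fin k) :
    u + u = c ↔ 2 * u.val = c.val ∨ 2 * u.val = c.val + k := by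
  have hu := u.2
  have hc := c.2
  rw [Fin.ext_iff, Fin.val_add]
  rcases lt_or_ge (u.val + u.val) k with h | h
  · rw [Nat.mod_eq_of_lt h]; omega
  · rw [Nat.mod_eq_sub_mod h, Nat.mod_eq_of_lt (by omega)]; omega

theorem halfCard_of_odd (k : ℕ) [NeZero k] (hk : Odd k) (c : Fin k) : halfCard c = 1 := by
  obtain ⟨l, hl⟩ := hk
  have hc := c.2
  rw [halfCard, Finset.card_eq_one]
  rcases Nat.even_or_odd' c.val with ⟨m, hm | hm⟩
  · refine ⟨⟨m, by omega⟩, ?_⟩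
    ext u
    have := u.2
    simp only [Finset.mem_filter, Finset.mem_univ, true_and, add_self_eq_iff,
      Finset.mem_singleton]
    simp only [Fin.ext_iff]
    omega
  -- For odd c and k the half is (c + k) / 2.
  · refine ⟨⟨m + l + 1, by omega⟩, ?_⟩
    ext u
    have := u.2
    simp only [Finset.mem_filter, Finset.mem_univ, true_and, add_self_eq_iff,
      Finset.mem_singleton]
    simp only [Fin.ext_iff]
    omega

theorem halfCard_of_even_of_even (k : ℕ) [NeZero k] (hk : Even k) (c : Fin k)
    (hc : Even c.val) : halfCard c = 2 := by
  obtain ⟨l, hl⟩ := hk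
  obtain ⟨m, hm⟩ := hc
  have hc := c.2
  rw [halfCard, Finset.card_eq_two]
  refine ⟨⟨m, by omega⟩, ⟨m + l, by omega⟩, by simp only [ne_eq, Fin.mk.injEq]; omega, ?_⟩
  ext u
  have := u.2
  simp only [Finset.mem_filter, Finset.mem_univ, true_and, add_self_eq_iff,
    Finset.mem_singleton, Finset.mem_insert]
  simp only [Fin.ext_iff]
  omega

theorem halfCard_of_even_of_odd (k : ℕ) [NeZero k] (hk : Even k) (c : Fin k)
    (hc : Odd c.val) : halfCard c = 0 := by
  obtain ⟨l, hl⟩ := hk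
  obtain ⟨m, hm⟩ := hc
  rw [halfCard, Finset.card_eq_zero]
  ext u
  simp only [Finset.mem_filter, Finset.mem_univ, true_and, add_self_eq_iff, Finset.notMem_empty,
    iff_false]
  omega

open scoped Fin.CommRing in
theorem four_mul_abelianComplexity_of_dvd (k n : ℕ) [NeZero k] (hk : 2 ≤ k) (hn : k ≤ n)
    (h : (n : Fin k) = 0) :
    4 * abelianComplexity (genThueMorse k hk) n + 2 * k =
      k ^ 3 + k * halfCard (0 : Fin k) + 4 := by
  have h1 := card_image_shiftedPairs (n : Fin k)
  rw [← abelianComplexity_genThueMorse k n hk hn, h, if_pos rfl] at h1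
  have h2 := four_mul_card_shiftedPairs (0 : Fin k)
  have h3 := two_mul_card_meetingPairs_zero (G := Fin k)
  rw [Fintype.card_fin] at h2 h3
  linarith

open scoped Fin.CommRing in
theorem four_mul_abelianComplexity_of_not_dvd (k n : ℕ) [NeZero k] (hk : 2 ≤ k) (hn : k ≤ n)
    (h : (n : Fin k) ≠ 0) :
    4 * abelianComplexity (genThueMorse k hk) n + 2 * k ^ 2 =
      k ^ 3 + k * halfCard (n : Fin k) + 4 * k := by
  have h1 := card_image_shiftedPairs (n : Fin k)
  rw [← abelianComplexity_genThueMorse k n hk hn, if_neg h, card_meetingPairs _ h] at h1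
  have h2 := four_mul_card_shiftedPairs (n : Fin k)
  rw [Fintype.card_fin] at h1 h2
  linarith

theorem theorem1 (k n r : ℕ) (hk : 2 ≤ k) (hn : k ≤ n) (hr : r < k) (hnr : n ≡ r [MOD k]) :
    (Odd k → r = 0 →
      (abelianComplexity (genThueMorse k hk) n : ℚ) = 1 / 4 * k * ((k : ℚ) ^ 2 - 1) + 1) ∧
    (Odd k → r ≠ 0 →
      (abelianComplexity (genThueMorse k hk) n : ℚ) = 1 / 4 * k * ((k : ℚ) - 1) ^ 2 + k) ∧
    (Even k → r = 0 →
      (abelianComplexity (genThueMorse k hk) n : ℚ) = 1 / 4 * (k : ℚ) ^ 3 + 1) ∧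
    (Even k → r ≠ 0 → Even r →
      (abelianComplexity (genThueMorse k hk) n : ℚ) =
        1 / 4 * k * ((k : ℚ) - 1) ^ 2 + 5 / 4 * k) ∧
    (Even k → r ≠ 0 → Odd r →
      (abelianComplexity (genThueMorse k hk) n : ℚ) =
        1 / 4 * (k : ℚ) ^ 2 * ((k : ℚ) - 2) + k) := by
  have : NeZero k := ⟨by omega⟩
  have hval : (Fin.ofNat k n).val = r := by
    rw [Fin.val_ofNat, hnr, Nat.mod_eq_of_lt hr]
  have h0 : r = 0 → (4 * abelianComplexity (genThueMorse k hk) n + 2 * k : ℚ) =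
      k ^ 3 + k * halfCard (0 : Fin k) + 4 := fun h => by
    exact_mod_cast four_mul_abelianComplexity_of_dvd k n hk hn
      (Fin.ext (by rw [Fin.val_zero, ← h]; exact hval))
  have h1 : r ≠ 0 → (4 * abelianComplexity (genThueMorse k hk) n + 2 * k ^ 2 : ℚ) =
      k ^ 3 + k * halfCard (Fin.ofNat k n) + 4 * k := fun h => by
    exact_mod_cast four_mul_abelianComplexity_of_not_dvd k n hk hn
      (fun h' => h (by rw [← hval]; exact (congrArg Fin.val h').trans (Fin.val_zero k)))
  refine ⟨fun h2 h => ?_, fun h2 h => ?_, fun h2 h => ?_, fun h2 h h3 => ?_, fun h2 h h3 => ?_⟩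
  · have := h0 h
    rw [halfCard_of_odd k h2] at this
    push_cast at this
    linarith
  · have := h1 h
    rw [halfCard_of_odd k h2] at this
    push_cast at this
    linarith
  · have := h0 h
    rw [halfCard_of_even_of_even k h2 _ (by simp)] at this
    push_cast at this
    linarith
  · have := h1 h
    rw [halfCard_of_even_of_even k h2 _ (by rwa [hval])] at this
    push_cast at this
    linarith
  · have := h1 h
    rw [halfCard_of_even_of_odd k h2 _ (by rwa [hval])] at this
    push_cast at this
    linarith
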